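/- All graphs are finite, simple and undirected. For a graph $G$ let $\omega(G)$ be its number of connected components. A set $S\subseteq V(G)$ is a cutset if $\omega(G-S)>1$. For a real number $t$, $G$ is $t$-tough if $|S|\ge t\cdot\omega(G-S)$ for every cutset $S$ of $G$; the toughness $\tau(G)$ is the largest $t$ for which $G$ is $t$-tough, with $\tau(G)=\infty$ if $G$ is complete. $G$ is minimally $t$-tough if $\tau(G)=t$ and $\tau(G-e)<t$ for every edge $e$ of $G$. $G$ is an interval graph if it is the intersection graph of a family of (nonempty) intervals of the real line. A caterpillar is a tree such that removing all of its leaves (vertices of degree $1$) produces a (possibly empty) path. \textbf{Corollary.} Let $0<t\le 1/2$ be a real number. Every minimally $t$-tough interval graph is a caterpillar. -/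

import Mathlib

namespace SimpleGraph

/-- The number `ω(G)` of connected components of `G`. -/
noncomputable def numComponents {V : Type*} (G : SimpleGraph V) : ℕ :=
  Nat.card G.ConnectedComponent

/-- A vertex set `S` is a cutset of `G` if `ω(G - S) > 1`. -/
def IsCutset {V : Type*} (G : SimpleGraph V) (S : Set V) : Prop :=
  1 < (G.induce Sᶜ).numComponents

/-- `G` is `t`-tough if `|S| ≥ t · ω(G - S)` for every cutset `S` of `G`. -/
def IsTough {V : Type*} (G : SimpleGraph V) (t : ℝ) : Prop :=
  ∀ S : Set V, G.IsCutset S → t * ((G.induce Sᶜ).numComponents : ℝ) ≤ (S.ncard : ℝ)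

/-- The toughness `τ(G)` of a finite graph: the largest real `t` such that `G` is `t`-tough.
A complete graph has no cutset, hence is `t`-tough for every real `t`, and the supremum is then
`⊤ = ∞`, which is the usual convention for complete graphs. -/
noncomputable def toughness {V : Type*} (G : SimpleGraph V) : EReal :=
  sSup ((fun t : ℝ => (t : EReal)) '' {t : ℝ | G.IsTough t})

/-- `G` is minimally `t`-tough if `τ(G) = t` and `τ(G - e) < t` for every edge `e` of `G`. -/
def IsMinimallyTough {V : Type*} (G : SimpleGraph V) (t : ℝ) : Prop :=
  G.toughness = (t : EReal) ∧ ∀ e ∈ G.edgeSet, (G.deleteEdges {e}).toughness < (t : EReal)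

/-- `G` is an interval graph: it is the intersection graph of a family of (nonempty, open, closed,
half-open, possibly degenerate or unbounded) intervals of the real line. -/
def IsIntervalGraph {V : Type*} (G : SimpleGraph V) : Prop :=
  ∃ I : V → Set ℝ, (∀ v, (I v).Nonempty ∧ (I v).OrdConnected) ∧
    ∀ u v, G.Adj u v ↔ u ≠ v ∧ (I u ∩ I v).Nonempty

/-- A leaf is a vertex of degree one. -/
def IsLeaf {V : Type*} (G : SimpleGraph V) (v : V) : Prop :=
  (G.neighborSet v).ncard = 1

/-- A caterpillar is a tree for which removing all leaves produces a path
(the empty path arises only from the tree with a single edge). -/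
def IsCaterpillar {V : Type*} (G : SimpleGraph V) : Prop :=
  G.IsTree ∧ ∃ n : ℕ, Nonempty (G.induce {v | ¬ G.IsLeaf v} ≃g pathGraph n)

end SimpleGraph

/-!
Write `ω(H)` for the number of components of `H`. The proof shows that `G` is connected and
triangle-free, and that a connected triangle-free finite interval graph is a caterpillar.

*No triangles.* Let `u v w` be a triangle in which every neighbour of `w` lies in the closed
neighbourhood of `u` or of `v`. Minimality gives a cutset `S` of `G - uv` with
`|S| < t · ω(G - uv - S)`. Since `G` itself is `t`-tough, passing from `G - S` to `G - uv - S` must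
create a component, so `u, v ∉ S` and `w ∈ S`. Putting `w` and the edge `uv` back
merges at most the components of `u` and `v`, so `ω(G - (S \ {w})) ≥ ω(G - uv - S) - 1`. If
`S \ {w}` is a cutset, toughness gives `t (ω(G - uv - S) - 1) ≤ |S| - 1`, hence `|S| < |S| - 1 + t`;
otherwise `|S| < 2t ≤ 1` although `w ∈ S`. Both are impossible
(`IsMinimallyTough.exists_private_neighbor`). In an interval graph every triangle has such a
vertex `w`, because one of three pairwise intersecting intervals is covered by the other two
(`IsMinimallyTough.triangle_free`).

*Caterpillars.* A finite interval graph is represented by compact intervals `[l v, r v]`. In a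
cycle, the two neighbours of the vertex with the least right endpoint both contain that endpoint
and so form a triangle with it; hence triangle-free interval graphs are acyclic
(`IsIntervalRep.isAcyclic`). Without triangles, the interval of a vertex of degree at least two is
not contained in another interval, so left and right endpoints order the non-leaves in the same
way (`IsIntervalRep.left_lt_and_right_lt`). Absence of triangles forces adjacent non-leaves to be
consecutive in this order, and connectedness forces consecutive ones to be adjacent
(`IsIntervalRep.nonempty_iso_pathGraph`).
-/

namespace SimpleGraph

/-! ### Counting connected components -/

lemma Walk.apply_eq_of_forall_adj {V α : Type*} {G : SimpleGraph V} {f : V → α}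
    (hf : ∀ x y, G.Adj x y → f x = f y) {x y : V} (p : G.Walk x y) : f x = f y := by
  induction p with
  | nil => rfl
  | cons h _ ih => exact (hf _ _ h).trans ih

/-- A map to the components of `H` that is constant on the edges of `G` and misses at most one
component factors through the components of `G`. -/
lemma numComponents_le_succ {V W : Type*} [Finite V] {G : SimpleGraph V} {H : SimpleGraph W}
    (c₀ : H.ConnectedComponent) (f : V → H.ConnectedComponent)
    (hf : ∀ x y, G.Adj x y → f x = f y) (hs : ∀ c ≠ c₀, ∃ x, f x = c) :
    H.numComponents ≤ G.numComponents + 1 := by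
  classical
  let g : Option G.ConnectedComponent → H.ConnectedComponent := fun o =>
    o.elim c₀ (ConnectedComponent.lift f fun _ _ p _ => p.apply_eq_of_forall_adj hf)
  have hg : Function.Surjective g := by
    intro c
    by_cases hc : c = c₀
    · exact ⟨none, hc.symm⟩
    · obtain ⟨x, hx⟩ := hs c hc
      exact ⟨some (G.connectedComponentMk x), hx⟩
  have := Nat.card_le_card_of_surjective g hg
  rwa [Finite.card_option] at this

lemma numComponents_le_of_reachable {V : Type*} [Finite V] {G H : SimpleGraph V}
    (h : ∀ x y, G.Adj x y → H.Reachable x y) : H.numComponents ≤ G.numComponents := by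
  have hf : ∀ x y, G.Adj x y → H.connectedComponentMk x = H.connectedComponentMk y :=
    fun x y hxy => ConnectedComponent.sound (h x y hxy)
  refine Nat.card_le_card_of_surjective
    (ConnectedComponent.lift H.connectedComponentMk fun _ _ p _ => p.apply_eq_of_forall_adj hf) ?_
  intro c
  induction c using ConnectedComponent.ind with
  | h x => exact ⟨G.connectedComponentMk x, rfl⟩

/-! ### Toughness -/

lemma IsTough.le_toughness {V : Type*} {G : SimpleGraph V} {t : ℝ} (h : G.IsTough t) :
    (t : EReal) ≤ G.toughness :=
  le_sSup ⟨t, h, rfl⟩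

/-- The supremum defining a finite toughness is attained. -/
lemma isTough_of_toughness_eq {V : Type*} {G : SimpleGraph V} {t : ℝ}
    (h : G.toughness = (t : EReal)) : G.IsTough t := by
  intro S hS
  have hpos : (0 : ℝ) < (G.induce Sᶜ).numComponents := by
    exact_mod_cast zero_lt_one.trans hS
  rw [← le_div_iff₀ hpos, ← EReal.coe_le_coe_iff, ← h]
  refine sSup_le ?_
  rintro _ ⟨t', ht', rfl⟩
  exact EReal.coe_le_coe_iff.2 ((le_div_iff₀ hpos).2 (ht' S hS))

lemma IsTough.connected {V : Type*} [Finite V] [Nonempty V] {G : SimpleGraph V} {t : ℝ}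
    (ht : 0 < t) (h : G.IsTough t) : G.Connected := by
  refine ⟨fun x y => ?_⟩
  by_contra hxy
  have hcut : G.IsCutset ∅ := by
    refine Finite.one_lt_card_iff_nontrivial.2
      ⟨connectedComponentMk _ ⟨x, by simp⟩, connectedComponentMk _ ⟨y, by simp⟩, fun he => hxy ?_⟩
    exact (ConnectedComponent.exact he).map (Embedding.induce _).toHom
  have h1 := h ∅ hcut
  have h2 : (1 : ℝ) < (G.induce (∅ : Set V)ᶜ).numComponents := by exact_mod_cast hcut
  simp only [Set.ncard_empty, Nat.cast_zero] at h1
  nlinarith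

lemma IsMinimallyTough.nonempty {V : Type*} {G : SimpleGraph V} {t : ℝ}
    (h : G.IsMinimallyTough t) : Nonempty V := by
  by_contra hV
  rw [not_nonempty_iff] at hV
  -- Without vertices there is no cutset, so every real is a lower bound of the toughness.
  have : G.IsTough (t + 1) := by
    intro S hS
    have : IsEmpty (G.induce Sᶜ).ConnectedComponent :=
      ⟨fun c => by induction c using ConnectedComponent.ind with | h x => exact hV.elim x.1⟩
    simp [IsCutset, numComponents] at hS
  have := this.le_toughness
  rw [h.1, EReal.coe_le_coe_iff] at this
  linarith

/-- In a triangle `u v w` of a minimally `t`-tough graph with `t ≤ 1 / 2`, the neighbourhood of `w`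
is not covered by the closed neighbourhoods of `u` and `v`. -/
lemma IsMinimallyTough.exists_private_neighbor {V : Type*} [Finite V] {G : SimpleGraph V} {t : ℝ}
    (ht0 : 0 < t) (ht : t ≤ 1 / 2) (hG : G.IsMinimallyTough t) {u v w : V}
    (huv : G.Adj u v) (huw : G.Adj u w) (hvw : G.Adj v w) :
    ∃ x, G.Adj w x ∧ x ≠ u ∧ x ≠ v ∧ ¬ G.Adj u x ∧ ¬ G.Adj v x := by
  classical
  by_contra! hcov
  have htough := isTough_of_toughness_eq hG.1
  have hnt : ¬ (G.deleteEdges {s(u, v)}).IsTough t := fun h =>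
    (hG.2 s(u, v) huv).not_ge h.le_toughness
  simp only [IsTough, not_forall, not_le] at hnt
  obtain ⟨S, hScut, hS⟩ := hnt
  set H := (G.deleteEdges {s(u, v)}).induce Sᶜ with hH
  -- Some edge of `G - S` joins different components of `G - uv - S`.
  have hsep : ∃ x y, (G.induce Sᶜ).Adj x y ∧ ¬ H.Reachable x y := by
    by_contra! hr
    have hle := numComponents_le_of_reachable hr
    have h1 := htough S (lt_of_lt_of_le hScut hle)
    have h2 : (H.numComponents : ℝ) ≤ (G.induce Sᶜ).numComponents := by exact_mod_cast hle
    nlinarith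
  have hadj : ∀ x y : (Sᶜ : Set V), G.Adj x y → s(x.1, y.1) ≠ s(u, v) → H.Adj x y := by
    intro x y hxy hne
    simp only [hH, comap_adj, deleteEdges_adj, Function.Embedding.subtype_apply]
    exact ⟨hxy, hne⟩
  have huvw : u ∉ S ∧ v ∉ S ∧ ∀ (hu : u ∉ S) (hv : v ∉ S), ¬ H.Reachable ⟨u, hu⟩ ⟨v, hv⟩ := by
    obtain ⟨⟨x, hx⟩, ⟨y, hy⟩, hxy, hr⟩ := hsep
    have he : s(x, y) = s(u, v) := by
      by_contra hne
      exact hr (hadj ⟨x, hx⟩ ⟨y, hy⟩ hxy hne).reachable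
    rcases Sym2.eq_iff.1 he with ⟨rfl, rfl⟩ | ⟨rfl, rfl⟩
    · exact ⟨hx, hy, fun _ _ => hr⟩
    · exact ⟨hy, hx, fun _ _ h => hr h.symm⟩
  obtain ⟨hu, hv, hr⟩ := huvw
  have hwS : w ∈ S := by
    by_contra hw
    refine hr hu hv ((hadj ⟨u, hu⟩ ⟨w, hw⟩ huw ?_).reachable.trans
      (hadj ⟨w, hw⟩ ⟨v, hv⟩ hvw.symm ?_).reachable)
    · simp [hvw.ne', huv.ne]
    · simp [huw.ne', huv.ne', hvw.ne']
  -- Restoring `w` and the edge `uv` merges no components besides those of `u` and `v`.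
  have hcount : H.numComponents ≤ (G.induce (S \ {w})ᶜ).numComponents + 1 := by
    let cu := H.connectedComponentMk ⟨u, hu⟩
    let cv := H.connectedComponentMk ⟨v, hv⟩
    let f : V → H.ConnectedComponent := fun x =>
      if hx : x ∈ S then cu else
        if H.connectedComponentMk ⟨x, hx⟩ = cv then cu else H.connectedComponentMk ⟨x, hx⟩
    have fS : ∀ x ∈ S, f x = cu := fun x hx => by simp [f, hx]
    have fu : f u = cu := by simp [f, hu, cu]
    have fv : f v = cu := by simp [f, hv, cv]
    have fadj : ∀ x y, x ∉ S → y ∉ S → G.Adj x y → f x = f y := by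
      intro x y hx hy hxy
      by_cases he : s(x, y) = s(u, v)
      · rcases Sym2.eq_iff.1 he with ⟨rfl, rfl⟩ | ⟨rfl, rfl⟩
        · rw [fu, fv]
        · rw [fu, fv]
      · have := ConnectedComponent.sound (hadj ⟨x, hx⟩ ⟨y, hy⟩ hxy he).reachable
        simp only [f, hx, hy, dif_neg, not_false_eq_true, this]
    have fw : ∀ x, x ∉ S → G.Adj w x → f x = cu := by
      intro x hx hwx
      by_cases hxu : x = u
      · rw [hxu, fu]
      by_cases hxv : x = v
      · rw [hxv, fv]
      by_cases hux : G.Adj u x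
      · rw [← fadj u x hu hx hux, fu]
      · rw [← fadj v x hv hx (hcov x hwx hxu hxv hux), fv]
    have hmem : ∀ x : ((S \ {w})ᶜ : Set V), x.1 ∈ S → x.1 = w := by
      intro x hx
      by_contra hne
      exact x.2 ⟨hx, hne⟩
    refine numComponents_le_succ cv (fun x => f x.1) ?_ ?_
    · intro x y hxy
      replace hxy : G.Adj x.1 y.1 := hxy
      change f x.1 = f y.1
      by_cases hx : x.1 ∈ S
      · have hxw := hmem x hx
        have hy : y.1 ∉ S := fun hy => hxy.ne (hxw.trans (hmem y hy).symm)
        rw [hxw] at hxy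
        rw [fS _ hx, fw _ hy hxy]
      · by_cases hy : y.1 ∈ S
        · rw [hmem y hy] at hxy
          rw [fS _ hy, fw _ hx hxy.symm]
        · exact fadj _ _ hx hy hxy
    · intro c hc
      induction c using ConnectedComponent.ind with
      | h x =>
        refine ⟨⟨x.1, fun h => x.2 h.1⟩, ?_⟩
        have hx : x.1 ∉ S := x.2
        simp only [f, hx, dif_neg, not_false_eq_true]
        exact if_neg hc
  have hcard : ((S \ {w}).ncard : ℝ) + 1 = S.ncard := by
    exact_mod_cast Set.ncard_sdiff_singleton_add_one hwS
  have hcountR : (H.numComponents : ℝ) ≤ (G.induce (S \ {w})ᶜ).numComponents + 1 := by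
    exact_mod_cast hcount
  by_cases hcut : G.IsCutset (S \ {w})
  · have := htough _ hcut
    nlinarith
  · have h1 : ((G.induce (S \ {w})ᶜ).numComponents : ℝ) ≤ 1 := by
      exact_mod_cast not_lt.1 hcut
    have h2 : (0 : ℝ) ≤ (S \ {w}).ncard := Nat.cast_nonneg _
    nlinarith

/-! ### Interval representations -/

/-- The compact intervals `[l v, r v]` of the real line represent the graph `G`. -/
structure IsIntervalRep {V : Type*} (G : SimpleGraph V) (l r : V → ℝ) : Prop where
  le : ∀ v, l v ≤ r v
  adj_iff : ∀ u v, G.Adj u v ↔ u ≠ v ∧ l u ≤ r v ∧ l v ≤ r u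

/-- A finite interval graph is represented by compact intervals: each interval is shrunk to the
hull of finitely many points, among them one in every nonempty pairwise intersection. -/
lemma IsIntervalGraph.exists_isIntervalRep {V : Type*} [Finite V] {G : SimpleGraph V}
    (hI : G.IsIntervalGraph) : ∃ l r : V → ℝ, G.IsIntervalRep l r := by
  obtain ⟨I, hI, hadj⟩ := hI
  have hp : ∀ u v, ∃ p, (I u ∩ I v).Nonempty → p ∈ I u ∩ I v := fun u v => by
    by_cases h : (I u ∩ I v).Nonempty
    · exact ⟨h.some, fun _ => h.some_mem⟩
    · exact ⟨0, fun h' => absurd h' h⟩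
  choose p hp using hp
  let P : V → Set ℝ := fun u => Set.range (fun q : V × V => p q.1 q.2) ∩ I u
  have hfin : ∀ u, (P u).Finite := fun u => (Set.finite_range _).inter_of_left _
  have hne : ∀ u, (P u).Nonempty := fun u =>
    ⟨p u u, ⟨(u, u), rfl⟩, (hp u u (by simpa using (hI u).1)).1⟩
  have hl : ∀ u, sInf (P u) ∈ I u := fun u => ((hne u).csInf_mem (hfin u)).2
  have hr : ∀ u, sSup (P u) ∈ I u := fun u => ((hne u).csSup_mem (hfin u)).2
  have hlr : ∀ u, sInf (P u) ≤ sSup (P u) := fun u =>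
    csInf_le_csSup (hne u) (hfin u).bddBelow (hfin u).bddAbove
  refine ⟨fun u => sInf (P u), fun u => sSup (P u), hlr, fun u v => ?_⟩
  rw [hadj]
  refine and_congr_right fun _ => ⟨fun h => ?_, fun ⟨h1, h2⟩ => ?_⟩
  · have hu : p u v ∈ P u := ⟨⟨(u, v), rfl⟩, (hp u v h).1⟩
    have hv : p u v ∈ P v := ⟨⟨(u, v), rfl⟩, (hp u v h).2⟩
    exact ⟨(csInf_le (hfin u).bddBelow hu).trans (le_csSup (hfin v).bddAbove hv),
      (csInf_le (hfin v).bddBelow hv).trans (le_csSup (hfin u).bddAbove hu)⟩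
  · exact ⟨max (sInf (P u)) (sInf (P v)),
      (hI u).2.out (hl u) (hr u) ⟨le_max_left _ _, max_le (hlr u) h2⟩,
      (hI v).2.out (hl v) (hr v) ⟨le_max_right _ _, max_le h1 (hlr v)⟩⟩

lemma IsMinimallyTough.triangle_free {V : Type*} [Finite V] {G : SimpleGraph V} {t : ℝ}
    (ht0 : 0 < t) (ht : t ≤ 1 / 2) (hG : G.IsMinimallyTough t) {l r : V → ℝ}
    (h : G.IsIntervalRep l r) (u v w : V) (huv : G.Adj u v) (huw : G.Adj u w)
    (hvw : G.Adj v w) : False := by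
  -- If `u` starts first and `v` ends after `w`, then the interval of `w` is covered.
  have key : ∀ u v w, G.Adj u v → G.Adj u w → G.Adj v w → l u ≤ l w → r w ≤ r v → False := by
    intro u v w huv huw hvw hl hr
    obtain ⟨x, hwx, hxu, hxv, hux, hvx⟩ := hG.exists_private_neighbor ht0 ht huv huw hvw
    rw [h.adj_iff] at hux hvx hwx huv
    have := h.le x
    by_cases hx : l x ≤ r u
    · exact hux ⟨hxu.symm, hl.trans hwx.2.1, hx⟩
    · exact hvx ⟨hxv.symm, by linarith, by linarith⟩
  -- The vertex with the least left endpoint plays the role of `u`.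
  have key' : ∀ u v w, G.Adj u v → G.Adj u w → G.Adj v w → l u ≤ l v → l u ≤ l w → False := by
    intro u v w huv huw hvw hlv hlw
    rcases le_total (r v) (r w) with hr | hr
    · exact key u w v huw huv hvw.symm hlv hr
    · exact key u v w huv huw hvw hlw hr
  rcases le_total (l u) (l v) with h1 | h1
  · rcases le_total (l u) (l w) with h2 | h2
    · exact key' u v w huv huw hvw h1 h2
    · exact key' w u v huw.symm hvw.symm huv h2 (h2.trans h1)
  · rcases le_total (l v) (l w) with h2 | h2
    · exact key' v u w huv.symm hvw huw h1 h2
    · exact key' w u v huw.symm hvw.symm huv (h2.trans h1) h2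

/-! ### Triangle-free interval graphs -/

lemma IsIntervalRep.isAcyclic {V : Type*} {G : SimpleGraph V} {l r : V → ℝ}
    (h : G.IsIntervalRep l r)
    (htri : ∀ u v w, G.Adj u v → G.Adj u w → G.Adj v w → False) : G.IsAcyclic := by
  classical
  intro a c hc
  obtain ⟨x, hx, hmin⟩ := Finset.exists_min_image c.support.toFinset r ⟨a, by simp⟩
  rw [List.mem_toFinset] at hx
  have hc' := hc.rotate hx
  set c' := c.rotate x hx with hc'_def
  have hmin' : ∀ y ∈ c'.support, r x ≤ r y := by
    intro y hy
    exact hmin y (by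
      rw [List.mem_toFinset]
      rwa [hc'_def, Walk.mem_support_rotate_iff] at hy)
  have h1 : G.Adj x c'.snd := c'.adj_snd hc'.not_nil
  have h2 : G.Adj c'.penultimate x := c'.adj_penultimate hc'.not_nil
  have h3 := hmin' _ (c'.getVert_mem_support 1)
  have h4 := hmin' _ (c'.getVert_mem_support (c'.length - 1))
  refine htri x _ _ h1 h2.symm ((h.adj_iff _ _).2 ⟨hc'.snd_ne_penultimate, ?_, ?_⟩)
  · exact ((h.adj_iff _ _).1 h1).2.2.trans h4
  · exact ((h.adj_iff _ _).1 h2).2.1.trans h3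

lemma not_isLeaf_of_adj {V : Type*} {G : SimpleGraph V} {x y z : V} (hy : G.Adj x y)
    (hz : G.Adj x z) (hyz : y ≠ z) : ¬ G.IsLeaf x := by
  intro hx
  obtain ⟨a, ha⟩ := Set.ncard_eq_one.1 hx
  have h1 : y ∈ G.neighborSet x := hy
  have h2 : z ∈ G.neighborSet x := hz
  rw [ha, Set.mem_singleton_iff] at h1 h2
  exact hyz (h1.trans h2.symm)

lemma exists_adj_ne_of_not_isLeaf {V : Type*} {G : SimpleGraph V} {x y : V} (hx : ¬ G.IsLeaf x)
    (hy : G.Adj x y) : ∃ z, G.Adj x z ∧ z ≠ y := by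
  by_contra! hz
  exact hx (Set.ncard_eq_one.2 ⟨y, Set.ext fun z => ⟨hz z, fun h => h ▸ hy⟩⟩)

/-- The left endpoints and the right endpoints order distinct non-leaves in the same way: a
non-leaf interval contained in that of `y` would have a second neighbour, which is then
adjacent to `y` too. -/
lemma IsIntervalRep.left_lt_and_right_lt {V : Type*} {G : SimpleGraph V} {l r : V → ℝ}
    (h : G.IsIntervalRep l r)
    (htri : ∀ u v w, G.Adj u v → G.Adj u w → G.Adj v w → False) {x y : V}
    (hx : ¬ G.IsLeaf x) (hy : ¬ G.IsLeaf y) (hxy : x ≠ y) :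
    (l x < l y ∧ r x < r y) ∨ (l y < l x ∧ r y < r x) := by
  have key : ∀ x y, ¬ G.IsLeaf x → x ≠ y → l y ≤ l x → r x ≤ r y → False := by
    intro x y hx hxy hl hr
    have hadj : G.Adj x y :=
      (h.adj_iff x y).2 ⟨hxy, (h.le x).trans hr, hl.trans (h.le x)⟩
    obtain ⟨z, hxz, hzy⟩ := exists_adj_ne_of_not_isLeaf hx hadj
    have hxz' := (h.adj_iff x z).1 hxz
    exact htri x y z hadj hxz
      ((h.adj_iff y z).2 ⟨hzy.symm, hl.trans hxz'.2.1, hxz'.2.2.trans hr⟩)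
  rcases lt_or_ge (l x) (l y) with h1 | h1
  · exact .inl ⟨h1, lt_of_not_ge fun h2 => key y x hy hxy.symm h1.le h2⟩
  · have h2 : r y < r x := lt_of_not_ge fun h2 => key x y hx hxy h1 h2
    exact .inr ⟨lt_of_not_ge fun h3 => key y x hy hxy.symm h3 h2.le, h2⟩

/-- The non-leaves, ordered by left endpoints, form a path. -/
lemma IsIntervalRep.nonempty_iso_pathGraph {V : Type*} [Finite V] {G : SimpleGraph V}
    {l r : V → ℝ} (h : G.IsIntervalRep l r)
    (htri : ∀ u v w, G.Adj u v → G.Adj u w → G.Adj v w → False) (hconn : G.Connected) :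
    ∃ n : ℕ, Nonempty (G.induce {v | ¬ G.IsLeaf v} ≃g pathGraph n) := by
  classical
  have hord : ∀ {x y : V}, ¬ G.IsLeaf x → ¬ G.IsLeaf y → l x < l y → r x < r y := by
    intro x y hx hy hl
    rcases h.left_lt_and_right_lt htri hx hy (by rintro rfl; exact hl.false) with h1 | h1
    · exact h1.2
    · exact absurd hl h1.1.not_gt
  let N := {v : V | ¬ G.IsLeaf v}
  have hinj : Function.Injective (fun x : N => l x) := by
    intro x y hxy
    by_contra hne
    rcases h.left_lt_and_right_lt htri x.2 y.2 (fun he => hne (Subtype.ext he)) with h1 | h1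
    · exact h1.1.ne hxy
    · exact h1.1.ne' hxy
  let _ : LinearOrder N := LinearOrder.lift' (fun x : N => l x) hinj
  have hlt : ∀ x y : N, x < y ↔ l x < l y := fun _ _ => Iff.rfl
  have : Fintype N := Fintype.ofFinite N
  let φ : Fin (Fintype.card N) ≃o N := Fintype.orderIsoFinOfCardEq N rfl
  have key : ∀ x y : N, x < y → (G.Adj x y ↔ x ⋖ y) := by
    intro x y hxy
    have hl := (hlt x y).1 hxy
    have hne : x.1 ≠ y.1 := fun he => hl.ne (congrArg l he)
    constructor
    · intro hadj
      refine ⟨hxy, fun z hxz hzy => ?_⟩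
      have h1 := (hlt x z).1 hxz
      have h2 := (hlt z y).1 hzy
      have h3 := hord x.2 z.2 h1
      have hyx := ((h.adj_iff _ _).1 hadj).2.2
      have hz := h.le z
      refine htri x z y ?_ hadj ?_
      · exact (h.adj_iff _ _).2 ⟨fun he => h1.ne (congrArg l he), h1.le.trans hz, h2.le.trans hyx⟩
      · exact (h.adj_iff _ _).2
          ⟨fun he => h2.ne (congrArg l he), h2.le.trans (h.le y), hyx.trans h3.le⟩
    · intro hcov
      by_contra hnadj
      have hgap : r x < l y := by
        by_contra! hge
        exact hnadj ((h.adj_iff _ _).2 ⟨hne, hl.le.trans (h.le y), hge⟩)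
      -- By connectedness some edge `ab` crosses the gap after `r x`; its left end `a` is then a
      -- non-leaf strictly between `x` and `y`.
      obtain ⟨p⟩ := hconn.preconnected x.1 y.1
      obtain ⟨d, -, hd1, hd2⟩ := p.exists_boundary_dart {v | l v ≤ r x} (h.le x)
        (by simpa using hgap)
      set a := d.fst
      set b := d.snd
      have hab : G.Adj a b := d.adj
      have ha : l a ≤ r x := hd1
      have hb : r x < l b := not_le.1 hd2
      have hab' := (h.adj_iff _ _).1 hab
      have hra : r x < r a := hb.trans_le hab'.2.2
      have hxa : x.1 ≠ a := fun he => hra.ne (congrArg r he)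
      have hax : G.Adj a x := (h.adj_iff _ _).2
        ⟨hxa.symm, ha, (h.le x).trans hra.le⟩
      have hxb : x.1 ≠ b := fun he => by
        have := h.le x
        rw [← he] at hb
        exact hb.not_ge this
      have haN : ¬ G.IsLeaf a := not_isLeaf_of_adj hax hab hxb
      have hla : l x < l a := by
        rcases h.left_lt_and_right_lt htri x.2 haN hxa with h1 | h1
        · exact h1.1
        · exact absurd hra h1.2.not_gt
      exact hcov.2 (c := ⟨a, haN⟩) ((hlt _ _).2 hla) ((hlt _ _).2 (ha.trans_lt hgap))
  refine ⟨Fintype.card N, ⟨RelIso.symm ⟨φ.toEquiv, ?_⟩⟩⟩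
  intro i j
  change G.Adj (φ i) (φ j) ↔ (hasse (Fin (Fintype.card N))).Adj i j
  rw [hasse_adj, ← apply_covBy_apply_iff φ, ← apply_covBy_apply_iff φ]
  rcases lt_trichotomy (φ i) (φ j) with hij | hij | hij
  · rw [key _ _ hij]
    exact ⟨.inl, fun h => h.resolve_right fun h => h.lt.not_gt hij⟩
  · simp [hij]
  · rw [G.adj_comm, key _ _ hij]
    exact ⟨.inr, fun h => h.resolve_left fun h => h.lt.not_gt hij⟩

end SimpleGraph

theorem mainTheorem2 {V : Type*} [Finite V] (G : SimpleGraph V) (t : ℝ) (ht0 : 0 < t)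
    (ht : t ≤ 1 / 2) (hG : G.IsMinimallyTough t) (hI : G.IsIntervalGraph) :
    G.IsCaterpillar := by
  obtain ⟨l, r, hrep⟩ := hI.exists_isIntervalRep
  have htri := hG.triangle_free ht0 ht hrep
  have := hG.nonempty
  have hconn := (SimpleGraph.isTough_of_toughness_eq hG.1).connected ht0
  exact ⟨⟨hconn, hrep.isAcyclic htri⟩, hrep.nonempty_iso_pathGraph htri hconn⟩
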